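/- Logarithms are natural. Let $\mathcal X,\mathcal Y$ be finite alphabets, let $P_{XY}$ be a joint probability distribution on $\mathcal X\times\mathcal Y$, and let $\rho>0$. For a random variable $U$ with values in a finite alphabet $\mathcal U$, an oblivious (memoryless) adversary presents i.i.d. guesses $\hat U_1^\infty=(\hat U_1,\hat U_2,\dots)$ drawn from a distribution $P_{\hat U}$ on $\mathcal U$, independently of $U$. The guessing number is $G(U,\hat U_1^\infty)=\inf\{k\ge 1:\hat U_k=U\}$ and the cost is $$V_\rho(U,\hat U_1^\infty)=\binom{G(U,\hat U_1^\infty)+\rho-1}{\rho},\qquad \binom{x}{y}=\frac{\Gamma(x+1)}{\Gamma(y+1)\Gamma(x-y+1)},$$ with $V_\rho=\infty$ if $G=\infty$. The oblivious maximal $\rho$-guesswork leakage from $X$ to $Y$ is $$\mathcal L_\rho^{\mathrm{oblv}\text{-}G}(X\to Y)=\sup_{U:\,U-X-Y}\log\frac{\inf_{P_{\hat U}}\mathbb E[V_\rho(U,\hat U_1^\infty)]}{\inf_{P_{\hat U|Y}}\sum_{y\in\mathcal Y}P_Y(y)\,\mathbb E[V_\rho(U,\hat U_1^\infty)\mid Y=y]},$$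 where the supremum is over all $U$ with values in an arbitrary finite alphabet such that $U-X-Y$ is a Markov chain, and, in the denominator, given $Y=y$ the guesses are i.i.d. with distribution $P_{\hat U|Y=y}$ and independent of $U$. For $\alpha\in(0,1)\cup(1,\infty)$ the Arimoto mutual information of order $\alpha$ of a pair $(X,Y)$ with joint distribution $P_{XY}$ is $$I_\alpha^{\mathrm A}(X;Y)=\frac{1}{1-\alpha}\log\sum_{x}P_X(x)^\alpha-\frac{\alpha}{1-\alpha}\log\sum_{y:\,P_Y(y)>0}P_Y(y)\Big(\sum_{x}P_{X|Y}(x|y)^\alpha\Big)^{1/\alpha}.$$ Then $$\mathcal L_\rho^{\mathrm{oblv}\text{-}G}(X\to Y)=\rho\,\sup_{P_{\tilde X}\ll P_X} I^{\mathrm A}_{\frac{1}{1+\rho}}(\tilde X;Y),$$ where the supremum is over all distributions $P_{\tilde X}$ on $\mathcal X$ that are absolutely continuous with respect to $P_X$, and $I^{\mathrm A}(\tilde X;Y)$ is computed for the joint distribution $P_{\tilde X}(x)P_{Y|X}(y|x)$. -/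

import Mathlib

open MeasureTheory
open scoped ENNReal

noncomputable section

namespace ObliviousGuesswork

/-- The generalized binomial coefficient `Γ(x+1) / (Γ(y+1) Γ(x-y+1))`. -/
def genBinom (x y : ℝ) : ℝ :=
  Real.Gamma (x + 1) / (Real.Gamma (y + 1) * Real.Gamma (x - y + 1))

/-- The guessing number of `u` for the sequence of guesses `g 0, g 1, …`: the position, counted
from one, of the first correct guess, and `⊤` if no guess is correct. -/
def guessNumber {U : Type*} (u : U) (g : ℕ → U) : ℕ∞ :=
  sInf ((fun n : ℕ => ((n + 1 : ℕ) : ℕ∞)) '' {n | g n = u})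

/-- The cost `binom (k + ρ - 1) ρ` of succeeding at the `k`-th guess; it is `∞` if one never
succeeds. -/
def guessCost (ρ : ℝ) (k : ℕ∞) : ℝ≥0∞ :=
  if k = ⊤ then ∞ else ENNReal.ofReal (genBinom ((k.toNat : ℝ) + ρ - 1) ρ)

/-- The expected cost of guessing the fixed value `u` by i.i.d. guesses of law `Q`. The law of the
sequence of guesses is the infinite product of `Q`. -/
def expCostAt {U : Type*} (ρ : ℝ) (Q : PMF U) (u : U) : ℝ≥0∞ :=
  letI : MeasurableSpace U := ⊤
  ∫⁻ g : ℕ → U, guessCost ρ (guessNumber u g) ∂(Measure.infinitePi fun _ : ℕ => Q.toMeasure)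

/-- The expected cost of guessing a value with probability mass function `p` by i.i.d. guesses of
law `Q` that are independent of that value. -/
def expCost {U : Type*} [Fintype U] (ρ : ℝ) (p : U → ℝ≥0∞) (Q : PMF U) : ℝ≥0∞ :=
  ∑ u, p u * expCostAt ρ Q u

/-- The conditional probability mass function of the first coordinate given that the second is `b`
(only meaningful if `b` has positive probability). -/
def condFst {A B : Type*} (P : PMF (A × B)) (b : B) (a : A) : ℝ≥0∞ :=
  P (a, b) / P.map Prod.snd b

/-- The conditional probability mass function of the second coordinate given that the first is `a`
(only meaningful if `a` has positive probability). -/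
def condSnd {A B : Type*} (P : PMF (A × B)) (a : A) (b : B) : ℝ≥0∞ :=
  P (a, b) / P.map Prod.fst a

/-- The least expected cost of oblivious guessing, without side information. -/
def optCost {U : Type*} [Fintype U] (ρ : ℝ) (P : PMF U) : ℝ≥0∞ :=
  ⨅ Q : PMF U, expCost ρ (fun u => P u) Q

/-- The least expected cost of oblivious guessing of the first coordinate, when the law of the
guesses may depend on the second. Values `y` of probability zero contribute zero. -/
def optCondCost {U Y : Type*} [Fintype U] [Fintype Y] (ρ : ℝ) (P : PMF (U × Y)) : ℝ≥0∞ :=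
  ⨅ Q : Y → PMF U, ∑ y, P.map Prod.snd y * expCost ρ (condFst P y) (Q y)

/-- `R` is a joint law of `(U, X, Y)` such that `(X, Y)` has law `P` and `U - X - Y` is a Markov
chain, that is, `U` and `Y` are conditionally independent given `X`. -/
structure IsMarkovExtension {U X Y : Type*} (P : PMF (X × Y)) (R : PMF (U × X × Y)) : Prop where
  map_snd : R.map Prod.snd = P
  markov : ∀ u x y, R (u, x, y) * P.map Prod.fst x
    = R.map (fun z => (z.1, z.2.1)) (u, x) * P (x, y)

/-- The oblivious maximal `ρ`-guesswork leakage from `X` to `Y`. The supremum is over all finite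
alphabets and all `U` with values in it for which `U - X - Y` is a Markov chain. -/
def obliviousLeakage {X Y : Type*} [Fintype Y] (ρ : ℝ) (P : PMF (X × Y)) : EReal :=
  ⨆ (U : Type) (_ : Fintype U) (R : PMF (U × X × Y)) (_ : IsMarkovExtension P R),
    ENNReal.log (optCost ρ (R.map Prod.fst) / optCondCost ρ (R.map fun z => (z.1, z.2.2)))

/-- The Rényi entropy of order `α`. -/
def renyiEntropy {X : Type*} [Fintype X] (α : ℝ) (P : PMF X) : ℝ :=
  1 / (1 - α) * Real.log (∑ x, (P x).toReal ^ α)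

/-- The Arimoto conditional entropy of order `α` of the first coordinate given the second. Values
`y` of probability zero contribute zero. -/
def arimotoCondEntropy {X Y : Type*} [Fintype X] [Fintype Y] (α : ℝ) (P : PMF (X × Y)) : ℝ :=
  α / (1 - α) * Real.log
    (∑ y, (P.map Prod.snd y).toReal * (∑ x, (condFst P y x).toReal ^ α) ^ (1 / α))

/-- The Arimoto mutual information of order `α`. -/
def arimotoMI {X Y : Type*} [Fintype X] [Fintype Y] (α : ℝ) (P : PMF (X × Y)) : ℝ :=
  renyiEntropy α (P.map Prod.fst) - arimotoCondEntropy α P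

/-- Absolute continuity of discrete laws. -/
def AbsCont {X : Type*} (Q P : PMF X) : Prop := ∀ x, P x = 0 → Q x = 0

theorem map_fst_apply {X Y : Type*} [Fintype Y] (P : PMF (X × Y)) (x : X) :
    P.map Prod.fst x = ∑ y, P (x, y) := by
  classical
  rw [PMF.map_apply, ENNReal.tsum_prod', tsum_eq_single x]
  · simp [tsum_fintype]
  · intro b hb
    simp [hb.symm]

/-- The joint law of `(X̃, Y)`, where `X̃` has law `Q ≪ P_X` and `Y` is produced from `X̃` by the
channel `P_{Y|X}` of `P`. -/
def tiltedJoint {X Y : Type*} [Fintype X] [Fintype Y] (P : PMF (X × Y)) (Q : PMF X)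
    (h : AbsCont Q (P.map Prod.fst)) : PMF (X × Y) :=
  PMF.ofFintype (fun z => Q z.1 * condSnd P z.1 z.2) (by
    have key : ∀ x, ∑ y, Q x * condSnd P x y = Q x := by
      intro x
      by_cases hx : P.map Prod.fst x = 0
      · simp [h x hx]
      · rw [← Finset.mul_sum]
        simp only [condSnd, div_eq_mul_inv]
        rw [← Finset.sum_mul, ← map_fst_apply,
          ENNReal.mul_inv_cancel hx (PMF.apply_ne_top _ _), mul_one]
    rw [Fintype.sum_prod_type]
    simp only [key]
    have hQ := Q.tsum_coe
    rwa [tsum_fintype] at hQ)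

end ObliviousGuesswork

end

namespace ObliviousGuesswork

/-! Put α = 1/(1+ρ). The binomial costs are the coefficients of (1-z)^(-(ρ+1)), so guessing a fixed
`u` with law `Q` costs exactly Q(u)^(-ρ) (`expCostAt_eq`). By Jensen, the minimum of ∑ p(u)
Q(u)^(-ρ) over `Q` is (∑ p^α)^(1/α), attained at Q ∝ p^α. Each ratio of optimal costs is therefore
the exponential of ρ times an Arimoto information (`log_costRatio`), and for a channel from `X` it
depends on the input law only through the weights v = p^α, up to scale (`weightRatio`).

Upper bound: for U - X - Y, replacing `U` by the weights v(x) = ∑ p(u)^α P(x|u) keeps the numerator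
and, by Jensen, can only shrink the denominator (`costRatio_comp_le`); up to scale v = Q^α for some
Q ≪ P_X.

Lower bound: splitting each `x` into m(x) equally likely values of `U` produces the weights m^(1-α)
P_X^α (`costRatio_shatter`). Suitable integers `m` approximate any Q^α up to scale, and the ratio is
continuous there. -/

/-! ### Expected cost of i.i.d. guesses -/

theorem _root_.Real.Gamma_add_natCast {s : ℝ} (hs : 0 < s) (n : ℕ) :
    Real.Gamma (s + n) = Real.Gamma s * (ascPochhammer ℝ n).eval s := by
  induction n with
  | zero => simp
  | succ n ih =>
    rw [Nat.cast_succ, ← add_assoc, Real.Gamma_add_one (by positivity), ih,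
      ascPochhammer_succ_eval]
    ring

/-- Here `n` counts the failures before success, so the guessing number is `n + 1` and the cost
argument `k + ρ - 1` becomes `n + ρ`. -/
theorem genBinom_eq_multichoose {ρ : ℝ} (hρ : 0 < ρ) (n : ℕ) :
    genBinom (n + ρ) ρ = Ring.multichoose (ρ + 1) n := by
  have h := Ring.factorial_nsmul_multichoose_eq_ascPochhammer (ρ + 1) n
  rw [Polynomial.ascPochhammer_smeval_eq_eval, nsmul_eq_mul] at h
  have hG := Real.Gamma_add_natCast (s := ρ + 1) (by positivity) n
  have h0 : Real.Gamma (ρ + 1) ≠ 0 := (Real.Gamma_pos_of_pos (by positivity)).ne'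
  have h1 : (n.factorial : ℝ) ≠ 0 := by exact_mod_cast n.factorial_ne_zero
  rw [genBinom, show (n : ℝ) + ρ + 1 = ρ + 1 + n by ring, hG, ← h,
    show (n : ℝ) + ρ - ρ + 1 = n + 1 by ring, Real.Gamma_nat_eq_factorial]
  field_simp

theorem genBinom_nonneg {ρ : ℝ} (hρ : 0 < ρ) (n : ℕ) : 0 ≤ genBinom (n + ρ) ρ := by
  have h1 : 0 < Real.Gamma ((n : ℝ) + ρ + 1) := Real.Gamma_pos_of_pos (by positivity)
  have h2 : 0 < Real.Gamma (ρ + 1) := Real.Gamma_pos_of_pos (by positivity)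
  have h3 : 0 < Real.Gamma ((n : ℝ) + ρ - ρ + 1) := Real.Gamma_pos_of_pos (by
    rw [add_sub_cancel_right]; positivity)
  rw [genBinom]
  positivity

theorem hasSum_genBinom_mul_pow {ρ z : ℝ} (hρ : 0 < ρ) (hz0 : 0 ≤ z) (hz1 : z < 1) :
    HasSum (fun n : ℕ => genBinom (n + ρ) ρ * z ^ n) (1 / (1 - z) ^ (ρ + 1)) := by
  have h := (Real.one_div_one_sub_rpow_hasFPowerSeriesOnBall_zero (ρ + 1)).hasSum
    (y := z) (by simp [Real.enorm_eq_ofReal hz0, hz1])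
  simpa [genBinom_eq_multichoose hρ, Ring.multichoose_eq, FormalMultilinearSeries.ofScalars,
    mul_comm] using h

/-- The binomial series at z = 1 - q gives q^(-(ρ+1)); the success probability contributes one more
factor q. -/
theorem tsum_genBinom_mul_geometric {ρ : ℝ} (hρ : 0 < ρ) {q : ℝ≥0∞} (hq0 : q ≠ 0) (hq1 : q ≤ 1) :
    ∑' n : ℕ, ENNReal.ofReal (genBinom (n + ρ) ρ) * ((1 - q) ^ n * q) = q ^ (-ρ) := by
  have hqt : q ≠ ⊤ := ne_top_of_le_ne_top ENNReal.one_ne_top hq1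
  obtain ⟨t, ht, rfl⟩ : ∃ t : ℝ, 0 ≤ t ∧ q = ENNReal.ofReal t :=
    ⟨q.toReal, ENNReal.toReal_nonneg, (ENNReal.ofReal_toReal hqt).symm⟩
  have ht0 : 0 < t := by simpa using hq0
  have ht1 : t ≤ 1 := by simpa using hq1
  have hs := (hasSum_genBinom_mul_pow hρ (z := 1 - t) (by linarith) (by linarith)).mul_right t
  have key : ∀ n : ℕ, ENNReal.ofReal (genBinom (n + ρ) ρ) *
      ((1 - ENNReal.ofReal t) ^ n * ENNReal.ofReal t) =
      ENNReal.ofReal (genBinom (n + ρ) ρ * (1 - t) ^ n * t) := by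
    intro n
    have hg := genBinom_nonneg hρ n
    have h1t : 0 ≤ 1 - t := by linarith
    rw [ENNReal.ofReal_mul (by positivity), ENNReal.ofReal_mul hg, ENNReal.ofReal_pow h1t,
      ENNReal.ofReal_sub _ ht, ENNReal.ofReal_one, mul_assoc]
  simp only [key]
  rw [← ENNReal.ofReal_tsum_of_nonneg _ hs.summable, hs.tsum_eq, ENNReal.ofReal_rpow_of_pos ht0]
  · congr 1
    rw [sub_sub_cancel, Real.rpow_add ht0, Real.rpow_one, Real.rpow_neg ht]
    field_simp
  · intro n
    have hg := genBinom_nonneg hρ n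
    have h1t : 0 ≤ 1 - t := by linarith
    positivity

theorem guessNumber_eq_of_first {U : Type*} {u : U} {g : ℕ → U} {n : ℕ} (hn : g n = u)
    (h : ∀ k < n, g k ≠ u) : guessNumber u g = ((n + 1 : ℕ) : ℕ∞) := by
  refine IsLeast.csInf_eq ⟨⟨n, hn, rfl⟩, ?_⟩
  rintro _ ⟨k, hk, rfl⟩
  have : n ≤ k := not_lt.1 fun hkn => h k hkn hk
  exact Nat.cast_le.2 (Nat.succ_le_succ this)

theorem guessNumber_eq_top {U : Type*} {u : U} {g : ℕ → U} (h : ∀ k, g k ≠ u) :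
    guessNumber u g = ⊤ := by
  simp [guessNumber, h]

/-- The guess sequences whose first correct guess has index `n`. -/
def firstHit {U : Type*} (u : U) (n : ℕ) : Set (ℕ → U) :=
  Set.pi (Finset.range (n + 1)) fun k => if k = n then {u} else {u}ᶜ

theorem mem_firstHit {U : Type*} {u : U} {n : ℕ} {g : ℕ → U} :
    g ∈ firstHit u n ↔ g n = u ∧ ∀ k < n, g k ≠ u := by
  simp only [firstHit, Set.mem_pi, Finset.coe_range, Set.mem_Iio]
  constructor
  · intro h
    refine ⟨by simpa using h n n.lt_succ_self, fun k hk => ?_⟩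
    simpa [hk.ne] using h k (by omega)
  · rintro ⟨h1, h2⟩ k hk
    by_cases hkn : k = n
    · simp [hkn, h1]
    · simpa [hkn] using h2 k (by omega)

/-- Splitting over the disjoint first-hit cylinders reduces the integral of the cost to product
measures of cylinders. -/
theorem guessCost_guessNumber {U : Type*} (ρ : ℝ) (u : U) (g : ℕ → U) :
    guessCost ρ (guessNumber u g) =
      (∑' n : ℕ, (firstHit u n).indicator (fun _ => ENNReal.ofReal (genBinom (n + ρ) ρ)) g) +
        {g : ℕ → U | ∀ k, g k ≠ u}.indicator (fun _ => ∞) g := by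
  classical
  by_cases h : ∃ n, g n = u
  · have hf := Nat.find_spec h
    have hm : ∀ k < Nat.find h, g k ≠ u := fun k hk => Nat.find_min h hk
    rw [guessNumber_eq_of_first hf hm, tsum_eq_single (Nat.find h),
      Set.indicator_of_mem (mem_firstHit.2 ⟨hf, hm⟩), Set.indicator_of_notMem, guessCost, if_neg]
    · simp only [ENat.toNat_natCast, add_zero]
      congr 2
      push_cast
      ring
    · exact ENat.natCast_ne_top _
    · simpa using h
    · intro n hn
      refine Set.indicator_of_notMem (fun hg => hn ?_) _
      rw [mem_firstHit] at hg
      exact ((Nat.find_eq_iff h).2 ⟨hg.1, hg.2⟩).symm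
  · have h' : ∀ k, g k ≠ u := by simpa using h
    rw [guessNumber_eq_top h', Set.indicator_of_mem (show g ∈ {g : ℕ → U | ∀ k, g k ≠ u} from h')]
    simp [guessCost]

theorem expCostAt_eq {U : Type*} {ρ : ℝ} (hρ : 0 < ρ) (Q : PMF U) (u : U) :
    expCostAt ρ Q u = Q u ^ (-ρ) := by
  classical
  let _ : MeasurableSpace U := ⊤
  set μ : Measure (ℕ → U) := Measure.infinitePi fun _ : ℕ => Q.toMeasure with hμ
  have hq1 : Q u ≤ 1 := Q.coe_le_one u
  have hQu : Q.toMeasure {u} = Q u := PMF.toMeasure_apply_singleton _ _ trivial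
  have hQc : Q.toMeasure {u}ᶜ = 1 - Q u := by
    rw [prob_compl_eq_one_sub (show MeasurableSet {u} from trivial), hQu]
  have hmeas : ∀ n, MeasurableSet (firstHit u n) := fun n =>
    MeasurableSet.pi (Finset.countable_toSet _) fun _ _ => trivial
  have hfirst : ∀ n, μ (firstHit u n) = (1 - Q u) ^ n * Q u := by
    intro n
    rw [hμ, firstHit, Measure.infinitePi_pi _ fun _ _ => MeasurableSpace.measurableSet_top, Finset.prod_range_succ]
    simp only [if_true, hQu]
    congr 1
    rw [Finset.prod_congr rfl (g := fun _ => 1 - Q u)]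
    · simp
    · intro k hk
      rw [if_neg (Finset.mem_range.1 hk).ne, hQc]
  have hmn : MeasurableSet {g : ℕ → U | ∀ k, g k ≠ u} := by
    have : {g : ℕ → U | ∀ k, g k ≠ u} = Set.pi Set.univ fun _ => {u}ᶜ := by
      ext g; simp
    rw [this]
    exact MeasurableSet.univ_pi fun _ => trivial
  have hle : ∀ n : ℕ, μ {g : ℕ → U | ∀ k, g k ≠ u} ≤ (1 - Q u) ^ n := by
    intro n
    have : μ (Set.pi (Finset.range n) fun _ => {u}ᶜ) = (1 - Q u) ^ n := by
      rw [hμ, Measure.infinitePi_pi _ fun _ _ => MeasurableSpace.measurableSet_top]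
      simp [hQc]
    rw [← this]
    exact measure_mono fun g hg k _ => hg k
  have hint : expCostAt ρ Q u =
      (∑' n : ℕ, ENNReal.ofReal (genBinom (n + ρ) ρ) * ((1 - Q u) ^ n * Q u)) +
        ∞ * μ {g : ℕ → U | ∀ k, g k ≠ u} := by
    change ∫⁻ g, guessCost ρ (guessNumber u g) ∂μ = _
    simp only [guessCost_guessNumber]
    rw [lintegral_add_right _ (measurable_const.indicator hmn),
      lintegral_tsum fun n => (measurable_const.indicator (hmeas n)).aemeasurable,
      lintegral_indicator_const hmn]
    simp only [lintegral_indicator_const (hmeas _), hfirst]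
  rw [hint]
  by_cases hq0 : Q u = 0
  -- All first-hit events are null, so the never-hit event cannot be; the cost is then `∞`, which
  -- agrees with `0 ^ (-ρ)`.
  · have hone : μ {g : ℕ → U | ∀ k, g k ≠ u} ≠ 0 := by
      have hz : μ (⋃ n, firstHit u n) = 0 := by
        rw [measure_iUnion_null_iff]
        intro n
        rw [hfirst, hq0, mul_zero]
      have hsub : (Set.univ : Set (ℕ → U)) ⊆
          {g : ℕ → U | ∀ k, g k ≠ u} ∪ ⋃ n, firstHit u n := by
        intro g _
        by_cases h : ∃ n, g n = u
        · exact Or.inr (Set.mem_iUnion.2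
            ⟨Nat.find h, mem_firstHit.2 ⟨Nat.find_spec h, fun k hk => Nat.find_min h hk⟩⟩)
        · exact Or.inl (by simpa using h)
      intro h0
      have := measure_mono_null hsub (measure_union_null h0 hz)
      simp [hμ] at this
    rw [ENNReal.top_mul hone, add_top, hq0, ENNReal.zero_rpow_of_neg (by linarith)]
  · have hzero : μ {g : ℕ → U | ∀ k, g k ≠ u} = 0 := by
      have hlt : 1 - Q u < 1 := ENNReal.sub_lt_self ENNReal.one_ne_top one_ne_zero hq0
      exact le_antisymm (ge_of_tendsto' (ENNReal.tendsto_pow_atTop_nhds_zero_of_lt_one hlt) hle)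
        zero_le
    rw [hzero, mul_zero, add_zero, tsum_genBinom_mul_geometric hρ hq0 hq1]

/-! ### Optimal guessing laws and the quasi-norm -/

theorem map_snd_apply {A B : Type*} [Fintype A] (P : PMF (A × B)) (b : B) :
    P.map Prod.snd b = ∑ a, P (a, b) := by
  classical
  rw [PMF.map_apply, ENNReal.tsum_prod', tsum_fintype]
  refine Finset.sum_congr rfl fun a _ => ?_
  rw [tsum_eq_single b]
  · simp
  · intro c hc
    simp [hc.symm]

/-- The `ℓ^{1/(1+ρ)}` quasi-norm `(∑ p^{1/(1+ρ)})^{1+ρ}`. -/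
noncomputable def quasiNorm {A : Type*} [Fintype A] (ρ : ℝ) (p : A → ℝ≥0∞) : ℝ≥0∞ :=
  (∑ a, p a ^ (1 / (1 + ρ))) ^ (1 + ρ)

theorem quasiNorm_mul_left {A : Type*} [Fintype A] {ρ : ℝ} (hρ : 0 < ρ) (c : ℝ≥0∞)
    (p : A → ℝ≥0∞) : quasiNorm ρ (fun a => c * p a) = c * quasiNorm ρ p := by
  have h1 : 0 ≤ 1 / (1 + ρ) := by positivity
  have h2 : 0 ≤ 1 + ρ := by positivity
  have h3 : 1 + ρ ≠ 0 := by positivity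
  simp only [quasiNorm, ENNReal.mul_rpow_of_nonneg _ _ h1]
  rw [← Finset.mul_sum, ENNReal.mul_rpow_of_nonneg _ _ h2, ← ENNReal.rpow_mul,
    one_div_mul_cancel h3, ENNReal.rpow_one]

theorem sum_rpow_ne_top {A : Type*} [Fintype A] {ρ : ℝ} (hρ : 0 < ρ) {p : A → ℝ≥0∞}
    (hp : ∀ a, p a ≠ ⊤) : ∑ a, p a ^ (1 / (1 + ρ)) ≠ ⊤ :=
  ENNReal.sum_ne_top.2 fun a _ => ENNReal.rpow_ne_top_of_nonneg (by positivity) (hp a)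

theorem sum_rpow_ne_zero {A : Type*} [Fintype A] {ρ : ℝ} (hρ : 0 < ρ) {p : A → ℝ≥0∞} {a : A}
    (ha : p a ≠ 0) : ∑ a, p a ^ (1 / (1 + ρ)) ≠ 0 := by
  intro h
  have := Finset.sum_eq_zero_iff.1 h a (Finset.mem_univ a)
  rw [ENNReal.rpow_eq_zero_iff_of_pos (by positivity)] at this
  exact ha this

theorem quasiNorm_ne_top {A : Type*} [Fintype A] {ρ : ℝ} (hρ : 0 < ρ) {p : A → ℝ≥0∞}
    (hp : ∀ a, p a ≠ ⊤) : quasiNorm ρ p ≠ ⊤ :=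
  ENNReal.rpow_ne_top_of_nonneg (by positivity) (sum_rpow_ne_top hρ hp)

theorem quasiNorm_ne_zero {A : Type*} [Fintype A] {ρ : ℝ} (hρ : 0 < ρ) {p : A → ℝ≥0∞} {a : A}
    (ha : p a ≠ 0) : quasiNorm ρ p ≠ 0 := by
  rw [quasiNorm, Ne, ENNReal.rpow_eq_zero_iff_of_pos (by positivity)]
  exact sum_rpow_ne_zero hρ ha

theorem toReal_quasiNorm {A : Type*} [Fintype A] {ρ : ℝ} (hρ : 0 < ρ) {p : A → ℝ≥0∞}
    (hp : ∀ a, p a ≠ ⊤) :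
    (quasiNorm ρ p).toReal = (∑ a, (p a).toReal ^ (1 / (1 + ρ))) ^ (1 + ρ) := by
  rw [quasiNorm, ← ENNReal.toReal_rpow, ENNReal.toReal_sum
    fun a _ => ENNReal.rpow_ne_top_of_nonneg (by positivity) (hp a)]
  simp only [ENNReal.toReal_rpow]

theorem sum_apply_eq_one {A : Type*} [Fintype A] (Q : PMF A) : ∑ a, Q a = 1 := by
  simpa only [tsum_fintype] using Q.tsum_coe

/-- Jensen for t ↦ t^(1+ρ) under `Q`, applied to p^(1/(1+ρ))/Q. If `Q` misses a point charged by
`p`, the cost is infinite. -/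
theorem quasiNorm_le_expCost {A : Type*} [Fintype A] {ρ : ℝ} (hρ : 0 < ρ) (p : A → ℝ≥0∞)
    (Q : PMF A) : quasiNorm ρ p ≤ expCost ρ p Q := by
  simp only [expCost, expCostAt_eq hρ]
  by_cases h : ∃ a, p a ≠ 0 ∧ Q a = 0
  · obtain ⟨a, ha, hQ⟩ := h
    refine le_top.trans_eq (Eq.symm ?_)
    refine ENNReal.sum_eq_top.2 ⟨a, Finset.mem_univ a, ?_⟩
    rw [hQ, ENNReal.zero_rpow_of_neg (by linarith), ENNReal.mul_top ha]
  · push Not at h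
    have hJ := ENNReal.rpow_arith_mean_le_arith_mean_rpow Finset.univ (fun a => Q a)
      (fun a => p a ^ (1 / (1 + ρ)) / Q a) (sum_apply_eq_one Q) (p := 1 + ρ) (by linarith)
    refine le_trans (le_of_eq ?_) (hJ.trans (le_of_eq ?_))
    · rw [quasiNorm]
      congr 1
      refine Finset.sum_congr rfl fun a _ => ?_
      by_cases hQ : Q a = 0
      · have : p a = 0 := by
          by_contra hpa
          exact h a hpa hQ
        rw [hQ, this, zero_mul, ENNReal.zero_rpow_of_pos (by positivity)]
      · rw [ENNReal.mul_div_cancel hQ (Q.apply_ne_top a)]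
    · refine Finset.sum_congr rfl fun a _ => ?_
      by_cases hQ : Q a = 0
      · have : p a = 0 := by
          by_contra hpa
          exact h a hpa hQ
        rw [hQ, this, zero_mul, zero_mul]
      · have hQt := Q.apply_ne_top a
        rw [ENNReal.div_rpow_of_nonneg _ _ (by positivity), ← ENNReal.rpow_mul,
          one_div_mul_cancel (by positivity), ENNReal.rpow_one, div_eq_mul_inv, ← ENNReal.rpow_neg,
          mul_left_comm]
        congr 1
        nth_rewrite 1 [← ENNReal.rpow_one (Q a)]
        rw [← ENNReal.rpow_add _ _ hQ hQt]
        congr 1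
        ring

/-- The law proportional to a finite nonzero weight. -/
noncomputable def lawOfWeight {A : Type*} [Fintype A] (w : A → ℝ≥0∞) (h0 : ∑ a, w a ≠ 0)
    (ht : ∑ a, w a ≠ ⊤) : PMF A :=
  PMF.normalize w (by rwa [tsum_fintype]) (by rwa [tsum_fintype])

theorem lawOfWeight_apply {A : Type*} [Fintype A] (w : A → ℝ≥0∞) (h0 : ∑ a, w a ≠ 0)
    (ht : ∑ a, w a ≠ ⊤) (a : A) : lawOfWeight w h0 ht a = w a * (∑ a, w a)⁻¹ := by
  rw [lawOfWeight, PMF.normalize_apply, tsum_fintype]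

/-- The equality case of Jensen: Q ∝ p^(1/(1+ρ)). For p = 0 any law serves. -/
theorem exists_expCost_eq_quasiNorm {A : Type*} [Fintype A] [Nonempty A] {ρ : ℝ} (hρ : 0 < ρ)
    {p : A → ℝ≥0∞} (hp : ∀ a, p a ≠ ⊤) : ∃ Q : PMF A, expCost ρ p Q = quasiNorm ρ p := by
  by_cases h : ∃ a, p a ≠ 0
  · obtain ⟨a₀, ha₀⟩ := h
    have h0 := sum_rpow_ne_zero hρ ha₀
    have ht := sum_rpow_ne_top hρ hp
    refine ⟨lawOfWeight _ h0 ht, ?_⟩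
    simp only [expCost, expCostAt_eq hρ, lawOfWeight_apply, quasiNorm]
    set S := ∑ a, p a ^ (1 / (1 + ρ)) with hS
    have key : ∀ a, p a * (p a ^ (1 / (1 + ρ)) * S⁻¹) ^ (-ρ) = p a ^ (1 / (1 + ρ)) * S ^ ρ := by
      intro a
      by_cases ha : p a = 0
      · rw [ha, zero_mul, ENNReal.zero_rpow_of_pos (by positivity), zero_mul]
      · rw [ENNReal.mul_rpow_of_ne_top
          (ENNReal.rpow_ne_top_of_nonneg (by positivity) (hp a)) (ENNReal.inv_ne_top.2 h0),
          ENNReal.rpow_neg (S⁻¹), ENNReal.inv_rpow, inv_inv, ← mul_assoc, ← ENNReal.rpow_mul]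
        congr 1
        nth_rewrite 1 [← ENNReal.rpow_one (p a)]
        rw [← ENNReal.rpow_add _ _ ha (hp a)]
        congr 1
        field_simp
        ring
    simp only [key]
    rw [← Finset.sum_mul, ← hS]
    nth_rewrite 1 [← ENNReal.rpow_one S]
    rw [← ENNReal.rpow_add _ _ h0 ht]
  · push Not at h
    refine ⟨PMF.pure (Classical.arbitrary A), ?_⟩
    have h2 : 0 < (1 + ρ)⁻¹ := by positivity
    have h3 : 0 < 1 + ρ := by positivity
    simp [expCost, quasiNorm, h, ENNReal.zero_rpow_of_pos h2, ENNReal.zero_rpow_of_pos h3]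

theorem optCost_eq {A : Type*} [Fintype A] {ρ : ℝ} (hρ : 0 < ρ) (P : PMF A) :
    optCost ρ P = quasiNorm ρ fun a => P a := by
  have : Nonempty A := P.support_nonempty.to_type
  obtain ⟨Q, hQ⟩ := exists_expCost_eq_quasiNorm hρ fun a => P.apply_ne_top a
  exact le_antisymm ((iInf_le _ Q).trans hQ.le) (le_iInf fun Q => quasiNorm_le_expCost hρ _ Q)

theorem apply_le_map_snd {A B : Type*} [Fintype A] (P : PMF (A × B)) (a : A) (b : B) :
    P (a, b) ≤ P.map Prod.snd b := by
  rw [map_snd_apply]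
  exact Finset.single_le_sum (f := fun a => P (a, b)) (fun _ _ => zero_le) (Finset.mem_univ a)

theorem apply_le_map_fst {A B : Type*} [Fintype B] (P : PMF (A × B)) (a : A) (b : B) :
    P (a, b) ≤ P.map Prod.fst a := by
  rw [map_fst_apply]
  exact Finset.single_le_sum (f := fun b => P (a, b)) (fun _ _ => zero_le) (Finset.mem_univ b)

theorem map_snd_mul_condFst {A B : Type*} [Fintype A] (P : PMF (A × B)) (a : A) (b : B) :
    P.map Prod.snd b * condFst P b a = P (a, b) := by
  refine ENNReal.mul_div_cancel' (fun h => ?_) fun h => absurd h (PMF.apply_ne_top _ _)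
  exact le_antisymm (h ▸ apply_le_map_snd P a b) zero_le

theorem map_fst_mul_condSnd {A B : Type*} [Fintype B] (P : PMF (A × B)) (a : A) (b : B) :
    P.map Prod.fst a * condSnd P a b = P (a, b) := by
  refine ENNReal.mul_div_cancel' (fun h => ?_) fun h => absurd h (PMF.apply_ne_top _ _)
  exact le_antisymm (h ▸ apply_le_map_fst P a b) zero_le

theorem condFst_ne_top {A B : Type*} [Fintype A] (P : PMF (A × B)) (b : B) (a : A) :
    condFst P b a ≠ ⊤ :=
  ne_top_of_le_ne_top ENNReal.one_ne_top
    (ENNReal.div_le_of_le_mul (by rw [one_mul]; exact apply_le_map_snd P a b))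

theorem condSnd_ne_top {A B : Type*} [Fintype B] (P : PMF (A × B)) (a : A) (b : B) :
    condSnd P a b ≠ ⊤ :=
  ne_top_of_le_ne_top ENNReal.one_ne_top
    (ENNReal.div_le_of_le_mul (by rw [one_mul]; exact apply_le_map_fst P a b))

theorem map_snd_mul_quasiNorm_condFst {A B : Type*} [Fintype A] {ρ : ℝ} (hρ : 0 < ρ)
    (P : PMF (A × B)) (b : B) :
    P.map Prod.snd b * quasiNorm ρ (condFst P b) = quasiNorm ρ fun a => P (a, b) := by
  rw [← quasiNorm_mul_left hρ]
  simp only [map_snd_mul_condFst]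

/-- The guessing laws for different `b` are chosen independently, so the infimum is taken termwise;
homogeneity absorbs the factor P(b). -/
theorem optCondCost_eq {A B : Type*} [Fintype A] [Fintype B] {ρ : ℝ} (hρ : 0 < ρ)
    (P : PMF (A × B)) : optCondCost ρ P = ∑ b, quasiNorm ρ fun a => P (a, b) := by
  have : Nonempty A := P.support_nonempty.to_type.map Prod.fst
  choose Q hQ using fun b => exists_expCost_eq_quasiNorm hρ (condFst_ne_top P b)
  simp only [← map_snd_mul_quasiNorm_condFst hρ P]
  refine le_antisymm ((iInf_le _ Q).trans_eq ?_) (le_iInf fun Q => ?_)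
  · simp only [hQ]
  · gcongr
    exact quasiNorm_le_expCost hρ _ _

/-! ### Cost ratios, Arimoto information and data processing -/

/-- The ratio of the optimal costs without and with side information. -/
noncomputable def costRatio {A B : Type*} [Fintype A] [Fintype B] (ρ : ℝ) (p : A → ℝ≥0∞)
    (J : A → B → ℝ≥0∞) : ℝ≥0∞ :=
  quasiNorm ρ p / ∑ b, quasiNorm ρ fun a => J a b

theorem log_costRatio {A B : Type*} [Fintype A] [Fintype B] {ρ : ℝ} (hρ : 0 < ρ)
    (P : PMF (A × B)) :
    ENNReal.log (costRatio ρ (fun a => P.map Prod.fst a) fun a b => P (a, b)) =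
      ((ρ * arimotoMI (1 / (1 + ρ)) P : ℝ) : EReal) := by
  obtain ⟨⟨a₀, b₀⟩, hab⟩ := P.support_nonempty
  have hab : P (a₀, b₀) ≠ 0 := (P.mem_support_iff _).1 hab
  have hn0 : quasiNorm ρ (fun a => P.map Prod.fst a) ≠ 0 := by
    refine quasiNorm_ne_zero hρ (a := a₀) fun h => hab ?_
    exact le_antisymm (h ▸ apply_le_map_fst P a₀ b₀) zero_le
  have hnt : quasiNorm ρ (fun a => P.map Prod.fst a) ≠ ⊤ :=
    quasiNorm_ne_top hρ fun a => PMF.apply_ne_top _ a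
  have hdt : ∑ b, quasiNorm ρ (fun a => P (a, b)) ≠ ⊤ :=
    ENNReal.sum_ne_top.2 fun b _ => quasiNorm_ne_top hρ fun a => PMF.apply_ne_top _ _
  have hd0 : ∑ b, quasiNorm ρ (fun a => P (a, b)) ≠ 0 := fun h =>
    quasiNorm_ne_zero hρ (p := fun a => P (a, b₀)) hab
      (Finset.sum_eq_zero_iff.1 h b₀ (Finset.mem_univ _))
  rw [costRatio, ENNReal.log_pos_real (ENNReal.div_ne_zero.2 ⟨hn0, hdt⟩) (ENNReal.div_ne_top hnt hd0),
    EReal.coe_eq_coe_iff, ENNReal.toReal_div,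
    Real.log_div (ENNReal.toReal_ne_zero.2 ⟨hn0, hnt⟩) (ENNReal.toReal_ne_zero.2 ⟨hd0, hdt⟩),
    arimotoMI, renyiEntropy, arimotoCondEntropy,
    toReal_quasiNorm hρ fun a => PMF.apply_ne_top _ a]
  have hden : (∑ b, quasiNorm ρ (fun a => P (a, b))).toReal =
      ∑ b, (P.map Prod.snd b).toReal *
        (∑ a, (condFst P b a).toReal ^ (1 / (1 + ρ))) ^ (1 / (1 / (1 + ρ))) := by
    rw [ENNReal.toReal_sum fun b _ => quasiNorm_ne_top hρ fun a => PMF.apply_ne_top _ _]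
    refine Finset.sum_congr rfl fun b _ => ?_
    rw [← map_snd_mul_quasiNorm_condFst hρ, ENNReal.toReal_mul,
      toReal_quasiNorm hρ (condFst_ne_top P b), one_div_one_div]
  have hpos : 0 < ∑ a, (P.map Prod.fst a).toReal ^ (1 / (1 + ρ)) := by
    refine lt_of_le_of_ne (Finset.sum_nonneg fun a _ => by positivity) fun h => ?_
    apply ENNReal.toReal_ne_zero.2 ⟨hn0, hnt⟩
    rw [toReal_quasiNorm hρ fun a => PMF.apply_ne_top _ a, ← h, Real.zero_rpow (by positivity)]
  rw [hden, Real.log_rpow hpos]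
  have h1 : 1 - 1 / (1 + ρ) = ρ / (1 + ρ) := by field_simp; ring
  rw [h1]
  field_simp

/-- The cost ratio of the channel `W` as a function of the weights `v = p ^ (1 / (1 + ρ))` of the
input law `p`. -/
noncomputable def weightRatio {X Y : Type*} [Fintype X] [Fintype Y] (ρ : ℝ) (W : X → Y → ℝ≥0∞)
    (v : X → ℝ≥0∞) : ℝ≥0∞ :=
  (∑ x, v x) ^ (1 + ρ) / ∑ y, (∑ x, v x * W x y ^ (1 / (1 + ρ))) ^ (1 + ρ)

section

variable {U X Y : Type*} [Fintype U] [Fintype X] [Fintype Y] {ρ : ℝ}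

/-- Homogeneity of degree zero: weights never need to be normalised. -/
theorem weightRatio_mul_left (hρ : 0 < ρ) (W : X → Y → ℝ≥0∞) {c : ℝ≥0∞} (h0 : c ≠ 0) (ht : c ≠ ⊤)
    (v : X → ℝ≥0∞) : weightRatio ρ W (fun x => c * v x) = weightRatio ρ W v := by
  have h1 : 0 ≤ 1 + ρ := by positivity
  simp only [weightRatio, mul_assoc]
  simp only [← Finset.mul_sum, ENNReal.mul_rpow_of_nonneg _ _ h1]
  refine ENNReal.mul_div_mul_left _ _ ?_ (ENNReal.rpow_ne_top_of_nonneg h1 ht)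
  rw [Ne, ENNReal.rpow_eq_zero_iff_of_pos (by positivity)]
  exact h0

theorem costRatio_channel (hρ : 0 < ρ) (W : X → Y → ℝ≥0∞) (q : X → ℝ≥0∞) :
    costRatio ρ q (fun x y => q x * W x y) = weightRatio ρ W fun x => q x ^ (1 / (1 + ρ)) := by
  have h1 : 0 ≤ 1 / (1 + ρ) := by positivity
  simp only [costRatio, weightRatio, quasiNorm, ENNReal.mul_rpow_of_nonneg _ _ h1]

/-- Data processing: the cost ratio of a concatenated channel is at most that of its second
channel, for the weights that the first one produces. -/
theorem costRatio_comp_le (hρ : 0 < ρ) (W : X → Y → ℝ≥0∞) (p : U → ℝ≥0∞) (K : U → X → ℝ≥0∞)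
    (hK : ∀ u, ∑ x, K u x = p u) (hp : ∀ u, p u ≠ ⊤) :
    costRatio ρ p (fun u y => ∑ x, K u x * W x y) ≤
      weightRatio ρ W fun x => ∑ u, p u ^ (1 / (1 + ρ)) * (K u x / p u) := by
  have h1 : 0 < 1 / (1 + ρ) := by positivity
  have h2 : 0 < 1 + ρ := by positivity
  have hnum : ∑ x, ∑ u, p u ^ (1 / (1 + ρ)) * (K u x / p u) = ∑ u, p u ^ (1 / (1 + ρ)) := by
    rw [Finset.sum_comm]
    refine Finset.sum_congr rfl fun u _ => ?_
    simp only [div_eq_mul_inv]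
    rw [← Finset.mul_sum, ← Finset.sum_mul, hK]
    by_cases h : p u = 0
    · rw [h, ENNReal.zero_rpow_of_pos (by positivity), zero_mul]
    · rw [ENNReal.mul_inv_cancel h (hp u), mul_one]
  rw [costRatio, weightRatio, hnum]
  refine ENNReal.div_le_div le_rfl (Finset.sum_le_sum fun y _ => ?_)
  rw [quasiNorm]
  refine ENNReal.rpow_le_rpow ?_ h2.le
  simp only [Finset.sum_mul]
  rw [Finset.sum_comm]
  refine Finset.sum_le_sum fun u _ => ?_
  by_cases h : p u = 0
  · simp [h, ENNReal.zero_rpow_of_pos (show 0 < (1 + ρ)⁻¹ by positivity)]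
  have hw : ∑ x, K u x / p u = 1 := by
    simp only [div_eq_mul_inv]
    rw [← Finset.sum_mul, hK, ENNReal.mul_inv_cancel h (hp u)]
  -- Jensen under the conditional law of `x` given `u`; taking roots moves the power 1/(1+ρ) outside
  -- the mean.
  have hJ := ENNReal.rpow_arith_mean_le_arith_mean_rpow Finset.univ (fun x => K u x / p u)
    (fun x => W x y ^ (1 / (1 + ρ))) hw (p := 1 + ρ) (by linarith)
  simp only [← ENNReal.rpow_mul, one_div_mul_cancel h2.ne', ENNReal.rpow_one] at hJ
  have hJ' := ENNReal.rpow_le_rpow hJ h1.le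
  rw [← ENNReal.rpow_mul, mul_one_div_cancel h2.ne', ENNReal.rpow_one] at hJ'
  calc ∑ x, p u ^ (1 / (1 + ρ)) * (K u x / p u) * W x y ^ (1 / (1 + ρ))
      = p u ^ (1 / (1 + ρ)) * ∑ x, K u x / p u * W x y ^ (1 / (1 + ρ)) := by
        simp only [mul_assoc, Finset.mul_sum]
    _ ≤ p u ^ (1 / (1 + ρ)) * (∑ x, K u x / p u * W x y) ^ (1 / (1 + ρ)) := by gcongr
    _ = (∑ x, K u x * W x y) ^ (1 / (1 + ρ)) := by
        rw [← ENNReal.mul_rpow_of_nonneg _ _ h1.le, Finset.mul_sum]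
        congr 1
        refine Finset.sum_congr rfl fun x _ => ?_
        rw [← mul_assoc, ENNReal.mul_div_cancel h (hp u)]

theorem map_fst_tiltedJoint (P : PMF (X × Y)) (Q : PMF X) (h : AbsCont Q (P.map Prod.fst)) (x : X) :
    (tiltedJoint P Q h).map Prod.fst x = Q x := by
  rw [map_fst_apply]
  simp only [tiltedJoint, PMF.ofFintype_apply]
  by_cases hx : P.map Prod.fst x = 0
  · simp [h x hx]
  · simp only [condSnd, div_eq_mul_inv]
    rw [← Finset.mul_sum, ← Finset.sum_mul, ← map_fst_apply,
      ENNReal.mul_inv_cancel hx (PMF.apply_ne_top _ _), mul_one]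

theorem log_weightRatio_eq_arimotoMI (hρ : 0 < ρ) (P : PMF (X × Y)) (Q : PMF X)
    (h : AbsCont Q (P.map Prod.fst)) :
    ENNReal.log (weightRatio ρ (condSnd P) fun x => Q x ^ (1 / (1 + ρ))) =
      ((ρ * arimotoMI (1 / (1 + ρ)) (tiltedJoint P Q h) : ℝ) : EReal) := by
  rw [← log_costRatio hρ, ← costRatio_channel hρ]
  simp only [map_fst_tiltedJoint]
  rfl

/-! ### Upper bound: from Markov extensions to tilted inputs -/

theorem map_fst_snd_fst_apply (R : PMF (U × X × Y)) (u : U) (x : X) :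
    R.map (fun z => (z.1, z.2.1)) (u, x) = ∑ y, R (u, x, y) := by
  classical
  rw [PMF.map_apply, tsum_fintype, Fintype.sum_prod_type, Finset.sum_eq_single u,
    Fintype.sum_prod_type, Finset.sum_eq_single x]
  · simp
  · intro b _ hb
    simp [hb.symm]
  · simp
  · intro b _ hb
    simp [hb.symm]
  · simp

theorem map_fst_snd_snd_apply (R : PMF (U × X × Y)) (u : U) (y : Y) :
    R.map (fun z => (z.1, z.2.2)) (u, y) = ∑ x, R (u, x, y) := by
  classical
  rw [PMF.map_apply, tsum_fintype, Fintype.sum_prod_type, Finset.sum_eq_single u,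
    Fintype.sum_prod_type]
  · refine Finset.sum_congr rfl fun x _ => ?_
    simp
  · intro b _ hb
    simp [hb.symm]
  · simp

theorem optCost_div_optCondCost (hρ : 0 < ρ) (R : PMF (U × X × Y)) :
    optCost ρ (R.map Prod.fst) / optCondCost ρ (R.map fun z => (z.1, z.2.2)) =
      costRatio ρ (fun u => ∑ x, ∑ y, R (u, x, y)) fun u y => ∑ x, R (u, x, y) := by
  rw [optCost_eq hρ, optCondCost_eq hρ, costRatio]
  simp only [map_fst_snd_snd_apply, map_fst_apply, Fintype.sum_prod_type]

theorem IsMarkovExtension.eq_mul_condSnd {P : PMF (X × Y)} {R : PMF (U × X × Y)}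
    (hR : IsMarkovExtension P R) (u : U) (x : X) (y : Y) :
    R (u, x, y) = (∑ y, R (u, x, y)) * condSnd P x y := by
  have hle : ∀ y, R (u, x, y) ≤ P.map Prod.fst x := by
    intro y
    refine (apply_le_map_snd R u (x, y)).trans ?_
    rw [hR.map_snd]
    exact apply_le_map_fst P x y
  by_cases hx : P.map Prod.fst x = 0
  · have h0 : ∀ y, R (u, x, y) = 0 := fun y => le_antisymm (hx ▸ hle y) zero_le
    simp [h0]
  · have := hR.markov u x y
    rw [map_fst_snd_fst_apply] at this
    rw [condSnd, ← mul_div_assoc, ← this, ENNReal.mul_div_cancel_right hx (PMF.apply_ne_top _ _)]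

theorem IsMarkovExtension.exists_tilt (hρ : 0 < ρ) {P : PMF (X × Y)} {R : PMF (U × X × Y)}
    (hR : IsMarkovExtension P R) :
    ∃ Q : PMF X, AbsCont Q (P.map Prod.fst) ∧
      optCost ρ (R.map Prod.fst) / optCondCost ρ (R.map fun z => (z.1, z.2.2)) ≤
        weightRatio ρ (condSnd P) fun x => Q x ^ (1 / (1 + ρ)) := by
  have h1 : 0 < 1 / (1 + ρ) := by positivity
  have h2 : 0 < 1 + ρ := by positivity
  rw [optCost_div_optCondCost hρ]
  set K : U → X → ℝ≥0∞ := fun u x => ∑ y, R (u, x, y) with hKdef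
  set p : U → ℝ≥0∞ := fun u => ∑ x, K u x with hpdef
  have hKt : ∀ u x, K u x ≠ ⊤ := fun u x => ENNReal.sum_ne_top.2 fun y _ => PMF.apply_ne_top _ _
  have hp : ∀ u, p u ≠ ⊤ := fun u => ENNReal.sum_ne_top.2 fun x _ => hKt u x
  have hcomp := costRatio_comp_le hρ (condSnd P) p K (fun _ => rfl) hp
  have heq : (fun u y => ∑ x, R (u, x, y)) = fun u y => ∑ x, K u x * condSnd P x y := by
    funext u y
    exact Finset.sum_congr rfl fun x _ => hR.eq_mul_condSnd u x y
  rw [heq]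
  set v : X → ℝ≥0∞ := fun x => ∑ u, p u ^ (1 / (1 + ρ)) * (K u x / p u) with hv
  have hKp : ∀ u x, K u x ≤ p u := fun u x =>
    Finset.single_le_sum (f := fun x => K u x) (fun _ _ => zero_le) (Finset.mem_univ x)
  have hvt : ∀ x, v x ≠ ⊤ := fun x => ENNReal.sum_ne_top.2 fun u _ =>
    ENNReal.mul_ne_top (ENNReal.rpow_ne_top_of_nonneg h1.le (hp u))
      (ne_top_of_le_ne_top ENNReal.one_ne_top
        (ENNReal.div_le_of_le_mul (by rw [one_mul]; exact hKp u x)))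
  obtain ⟨⟨u₀, x₀, y₀⟩, hs⟩ := R.support_nonempty
  have hK0 : K u₀ x₀ ≠ 0 := fun h =>
    (R.mem_support_iff _).1 hs (Finset.sum_eq_zero_iff.1 h y₀ (Finset.mem_univ _))
  have hp0 : p u₀ ≠ 0 := fun h => hK0 (Finset.sum_eq_zero_iff.1 h x₀ (Finset.mem_univ _))
  have hv0 : v x₀ ≠ 0 := by
    intro h
    have := Finset.sum_eq_zero_iff.1 h u₀ (Finset.mem_univ _)
    rcases mul_eq_zero.1 this with h | h
    · rw [ENNReal.rpow_eq_zero_iff_of_pos h1] at h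
      exact hp0 h
    · exact (ENNReal.div_ne_zero.2 ⟨hK0, hp u₀⟩) h
  have hS0 : ∑ x, v x ^ (1 + ρ) ≠ 0 := by
    intro h
    have := Finset.sum_eq_zero_iff.1 h x₀ (Finset.mem_univ _)
    rw [ENNReal.rpow_eq_zero_iff_of_pos h2] at this
    exact hv0 this
  have hSt : ∑ x, v x ^ (1 + ρ) ≠ ⊤ :=
    ENNReal.sum_ne_top.2 fun x _ => ENNReal.rpow_ne_top_of_nonneg h2.le (hvt x)
  -- Q ∝ v^(1+ρ), so that Q^(1/(1+ρ)) is a multiple of `v`.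
  refine ⟨lawOfWeight _ hS0 hSt, fun x hx => ?_, hcomp.trans_eq ?_⟩
  · have hR0 : ∀ u y, R (u, x, y) = 0 := by
      intro u y
      refine le_antisymm ?_ zero_le
      rw [← hx]
      refine (apply_le_map_snd R u (x, y)).trans ?_
      rw [hR.map_snd]
      exact apply_le_map_fst P x y
    have : v x = 0 := by simp [hv, hKdef, hR0]
    rw [lawOfWeight_apply, this, ENNReal.zero_rpow_of_pos h2, zero_mul]
  · rw [← weightRatio_mul_left hρ (condSnd P) (c := (∑ x, v x ^ (1 + ρ))⁻¹ ^ (1 / (1 + ρ)))]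
    · congr 1
      funext x
      rw [lawOfWeight_apply, ENNReal.mul_rpow_of_nonneg _ _ h1.le, ← ENNReal.rpow_mul,
        mul_one_div_cancel h2.ne', ENNReal.rpow_one, mul_comm]
    · rw [Ne, ENNReal.rpow_eq_zero_iff_of_pos h1]
      exact ENNReal.inv_ne_zero.2 hSt
    · exact ENNReal.rpow_ne_top_of_nonneg h1.le (ENNReal.inv_ne_top.2 hS0)

end

/-! ### Lower bound: shattering the input and approximating tilts -/

open Filter Topology

section

variable {U X Y : Type*} [Fintype U] [Fintype X] [Fintype Y] {ρ : ℝ}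

open Classical in
/-- The joint law of `(U, X, Y)` in which `X = f U`, the law of `(X, Y)` is `P`, and `U` is
uniform on the fibre of `f` given `X`; the fibre over `x` has `m x` elements. -/
noncomputable def shatter (P : PMF (X × Y)) (f : U → X) (m : X → ℝ≥0∞)
    (hm0 : ∀ x, m x ≠ 0) (hmt : ∀ x, m x ≠ ⊤)
    (hf : ∀ g : X → ℝ≥0∞, ∑ u, g (f u) = ∑ x, m x * g x) : PMF (U × X × Y) :=
  PMF.ofFintype (fun z => if z.2.1 = f z.1 then P z.2 / m z.2.1 else 0) (by
    simp only [Fintype.sum_prod_type]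
    have h : ∀ u, ∑ x, ∑ y, (if x = f u then P (x, y) / m x else 0) =
        (fun x => (∑ y, P (x, y)) / m x) (f u) := by
      intro u
      rw [Finset.sum_eq_single (f u)]
      · simp [div_eq_mul_inv, Finset.sum_mul]
      · intro x _ hx
        simp [hx]
      · simp
    simp only [h]
    rw [hf fun x => (∑ y, P (x, y)) / m x]
    simp only [ENNReal.mul_div_cancel (hm0 _) (hmt _)]
    rw [← Fintype.sum_prod_type, sum_apply_eq_one])

variable (P : PMF (X × Y)) (f : U → X) (m : X → ℝ≥0∞) (hm0 : ∀ x, m x ≠ 0) (hmt : ∀ x, m x ≠ ⊤)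
  (hf : ∀ g : X → ℝ≥0∞, ∑ u, g (f u) = ∑ x, m x * g x)

open Classical in
theorem shatter_apply (u : U) (x : X) (y : Y) :
    shatter P f m hm0 hmt hf (u, x, y) = if x = f u then P (x, y) / m x else 0 := rfl

theorem isMarkovExtension_shatter : IsMarkovExtension P (shatter P f m hm0 hmt hf) := by
  classical
  refine ⟨?_, ?_⟩
  · ext ⟨x, y⟩
    rw [map_snd_apply]
    simp only [shatter_apply]
    rw [hf fun x' => if x = x' then P (x, y) / m x else 0]
    simp [ENNReal.mul_div_cancel (hm0 x) (hmt x)]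
  · intro u x y
    rw [map_fst_snd_fst_apply, map_fst_apply]
    simp only [shatter_apply]
    by_cases h : x = f u
    · simp only [h, if_true, div_eq_mul_inv]
      rw [← Finset.sum_mul]
      ring
    · simp [h]

/-- Each of the m(x) values of `U` over `x` has mass P_X(x)/m(x), and the weights add over the fibre
after the power is taken. -/
theorem costRatio_shatter (hρ : 0 < ρ) :
    optCost ρ ((shatter P f m hm0 hmt hf).map Prod.fst) /
        optCondCost ρ ((shatter P f m hm0 hmt hf).map fun z => (z.1, z.2.2)) =
      weightRatio ρ (condSnd P)
        fun x => m x * (P.map Prod.fst x / m x) ^ (1 / (1 + ρ)) := by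
  classical
  have h1 : 0 ≤ 1 / (1 + ρ) := by positivity
  have hxy : ∀ u y, ∑ x, shatter P f m hm0 hmt hf (u, x, y) =
      P.map Prod.fst (f u) / m (f u) * condSnd P (f u) y := by
    intro u y
    simp only [shatter_apply, ← map_fst_mul_condSnd P]
    simp [div_eq_mul_inv, mul_right_comm]
  have hx : ∀ u, ∑ x, ∑ y, shatter P f m hm0 hmt hf (u, x, y) =
      P.map Prod.fst (f u) / m (f u) := by
    intro u
    rw [Finset.sum_eq_single (f u)]
    · simp only [shatter_apply, if_true, map_fst_apply, div_eq_mul_inv, Finset.sum_mul]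
    · intro x _ hx
      simp [shatter_apply, hx]
    · simp
  rw [optCost_div_optCondCost hρ, costRatio, weightRatio]
  simp only [hx, hxy, quasiNorm, ENNReal.mul_rpow_of_nonneg _ _ h1]
  rw [hf fun x => (P.map Prod.fst x / m x) ^ (1 / (1 + ρ))]
  simp only [mul_assoc]
  congr 1
  refine Finset.sum_congr rfl fun y _ => ?_
  rw [hf fun x => (P.map Prod.fst x / m x) ^ (1 / (1 + ρ)) * condSnd P x y ^ (1 / (1 + ρ))]

end

section

variable {X Y : Type*} [Fintype X] [Fintype Y] {ρ : ℝ}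

/-- The fibres are indexed by `Fin (Fintype.card X)` because the leakage only ranges over alphabets
in `Type`, whereas `X` may live in any universe. -/
theorem exists_fintype_fibers (m : X → ℕ) :
    ∃ (U : Type) (_ : Fintype U) (f : U → X),
      ∀ g : X → ℝ≥0∞, ∑ u, g (f u) = ∑ x, (m x : ℝ≥0∞) * g x := by
  let e := (Fintype.equivFin X).symm
  refine ⟨(i : Fin (Fintype.card X)) × Fin (m (e i)), inferInstance, fun u => e u.1, fun g => ?_⟩
  rw [Fintype.sum_sigma]
  simp only [Finset.sum_const, Finset.card_univ, Fintype.card_fin, nsmul_eq_mul]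
  exact e.sum_comp fun x => (m x : ℝ≥0∞) * g x

theorem log_weightRatio_le_obliviousLeakage (hρ : 0 < ρ) (P : PMF (X × Y)) (m : X → ℕ)
    (hm : ∀ x, m x ≠ 0) :
    ENNReal.log (weightRatio ρ (condSnd P)
      fun x => m x * (P.map Prod.fst x / m x) ^ (1 / (1 + ρ))) ≤ obliviousLeakage ρ P := by
  obtain ⟨U, _, f, hf⟩ := exists_fintype_fibers m
  have hm0 : ∀ x, (m x : ℝ≥0∞) ≠ 0 := fun x => Nat.cast_ne_zero.2 (hm x)
  have hmt : ∀ x, (m x : ℝ≥0∞) ≠ ⊤ := fun x => ENNReal.natCast_ne_top _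
  rw [← costRatio_shatter P f (fun x => (m x : ℝ≥0∞)) hm0 hmt hf hρ]
  exact le_iSup_of_le U <| le_iSup_of_le _ <| le_iSup_of_le _ <|
    le_iSup_of_le (isMarkovExtension_shatter P f _ hm0 hmt hf) le_rfl

/-- A nonzero finite limit of the numerator excludes 0/0 and ∞/∞. -/
theorem tendsto_weightRatio (hρ : 0 < ρ) {W : X → Y → ℝ≥0∞} (hW : ∀ x y, W x y ≠ ⊤)
    {ι : Type*} {l : Filter ι} {v : ι → X → ℝ≥0∞} {w : X → ℝ≥0∞}
    (hv : ∀ x, Tendsto (fun i => v i x) l (𝓝 (w x))) (h0 : ∑ x, w x ≠ 0) (ht : ∑ x, w x ≠ ⊤) :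
    Tendsto (fun i => weightRatio ρ W (v i)) l (𝓝 (weightRatio ρ W w)) := by
  refine ENNReal.Tendsto.div (Filter.Tendsto.ennrpow_const _ (tendsto_finsetSum _ fun x _ => hv x))
    (Or.inl ?_) (tendsto_finsetSum _ fun y _ => Filter.Tendsto.ennrpow_const _
      (tendsto_finsetSum _ fun x _ => ENNReal.Tendsto.mul_const (hv x) (Or.inr ?_))) (Or.inr ?_)
  · rw [Ne, ENNReal.rpow_eq_zero_iff_of_pos (by positivity)]
    exact h0
  · exact ENNReal.rpow_ne_top_of_nonneg (by positivity) (hW x y)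
  · exact ENNReal.rpow_ne_top_of_nonneg (by positivity) ht

theorem tendsto_floor_add_one_div (w : ℝ) (hw : 0 ≤ w) :
    Tendsto (fun N : ℕ => ((⌊w * N⌋₊ + 1 : ℕ) : ℝ≥0∞) / ((N : ℕ) : ℝ≥0∞)) atTop
      (𝓝 (ENNReal.ofReal w)) := by
  have h1 : Tendsto (fun N : ℕ => (⌊w * N⌋₊ : ℝ) / N + 1 / N) atTop (𝓝 (w + 0)) :=
    ((tendsto_nat_floor_mul_div_atTop hw).comp tendsto_natCast_atTop_atTop).add
      tendsto_one_div_atTop_nhds_zero_nat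
  rw [add_zero] at h1
  refine (ENNReal.tendsto_ofReal h1).congr' ?_
  filter_upwards [eventually_gt_atTop 0] with N hN
  rw [← add_div, ENNReal.ofReal_div_of_pos (by exact_mod_cast hN), ENNReal.ofReal_natCast,
    ← Nat.cast_one, ← Nat.cast_add, ENNReal.ofReal_natCast]

theorem log_weightRatio_tilt_le (hρ : 0 < ρ) (P : PMF (X × Y)) (Q : PMF X)
    (h : AbsCont Q (P.map Prod.fst)) :
    ENNReal.log (weightRatio ρ (condSnd P) fun x => Q x ^ (1 / (1 + ρ))) ≤
      obliviousLeakage ρ P := by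
  have h1 : 0 < 1 / (1 + ρ) := by positivity
  have h2 : 0 < 1 - 1 / (1 + ρ) := by
    rw [sub_pos, div_lt_one (by positivity)]
    linarith
  set p : X → ℝ≥0∞ := fun x => P.map Prod.fst x with hp
  have hpt : ∀ x, p x ≠ ⊤ := fun x => PMF.apply_ne_top _ x
  -- The real-valued solution of w^(1-α) p^α = Q^α with α = 1/(1+ρ), since α/(1-α) = 1/ρ.
  set w : X → ℝ≥0∞ := fun x => (Q x / p x) ^ (1 / ρ) with hw
  have hwt : ∀ x, w x ≠ ⊤ := by
    intro x
    refine ENNReal.rpow_ne_top_of_nonneg (by positivity) ?_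
    by_cases hx : p x = 0
    · simp [h x hx]
    · exact ENNReal.div_ne_top (Q.apply_ne_top x) hx
  -- The `+ 1` keeps every fibre nonempty, even where `w` vanishes, and disappears after division by
  -- `N`.
  set m : ℕ → X → ℕ := fun N x => ⌊(w x).toReal * N⌋₊ + 1 with hm
  have hlim : ∀ x, Tendsto
      (fun N : ℕ => ((m N x : ℝ≥0∞) / (N : ℝ≥0∞)) ^ (1 - 1 / (1 + ρ)) * p x ^ (1 / (1 + ρ))) atTop
      (𝓝 (Q x ^ (1 / (1 + ρ)))) := by
    intro x
    have ht := ENNReal.Tendsto.mul_const (b := p x ^ (1 / (1 + ρ))) (Filter.Tendsto.ennrpow_const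
      (1 - 1 / (1 + ρ)) (tendsto_floor_add_one_div (w x).toReal ENNReal.toReal_nonneg))
      (Or.inr (ENNReal.rpow_ne_top_of_nonneg h1.le (hpt x)))
    convert ht using 2
    rw [ENNReal.ofReal_toReal (hwt x), hw, ← ENNReal.rpow_mul,
      show 1 / ρ * (1 - 1 / (1 + ρ)) = 1 / (1 + ρ) by field_simp; ring,
      ← ENNReal.mul_rpow_of_nonneg _ _ h1.le]
    congr 1
    exact (ENNReal.div_mul_cancel' (fun hx => h x hx) fun hx => absurd hx (hpt x)).symm
  obtain ⟨x₀, hx₀⟩ := Q.support_nonempty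
  refine le_of_tendsto ((ENNReal.continuous_log.tendsto _).comp (tendsto_weightRatio hρ
    (condSnd_ne_top P) hlim (sum_rpow_ne_zero hρ ((Q.mem_support_iff _).1 hx₀))
    (sum_rpow_ne_top hρ fun x => Q.apply_ne_top x))) ?_
  filter_upwards [eventually_gt_atTop 0] with N hN
  refine le_of_eq_of_le ?_ (log_weightRatio_le_obliviousLeakage hρ P (m N) fun x => by simp [hm])
  have hN0 : (N : ℝ≥0∞) ≠ 0 := Nat.cast_ne_zero.2 hN.ne'
  have hNt : (N : ℝ≥0∞) ≠ ⊤ := ENNReal.natCast_ne_top _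
  simp only [Function.comp_apply]
  -- Dividing `m` by `N` only rescales the weights, by N^(-(1-α)), so the ratio is that of an actual
  -- shattering.
  refine congrArg ENNReal.log (Eq.trans ?_ (weightRatio_mul_left hρ (condSnd P)
    (c := (N : ℝ≥0∞)⁻¹ ^ (1 - 1 / (1 + ρ))) ?_ ?_ _))
  · congr 1
    funext x
    have hmx : (m N x : ℝ≥0∞) ≠ 0 := Nat.cast_ne_zero.2 (by simp [hm])
    have hmxt : (m N x : ℝ≥0∞) ≠ ⊤ := ENNReal.natCast_ne_top _
    rw [ENNReal.div_rpow_of_nonneg _ _ h2.le, ENNReal.div_rpow_of_nonneg _ _ h1.le,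
      ENNReal.rpow_sub _ _ hmx hmxt, ENNReal.rpow_one, ENNReal.inv_rpow]
    simp only [div_eq_mul_inv, hp]
    ring
  · rw [Ne, ENNReal.rpow_eq_zero_iff_of_pos h2]
    exact ENNReal.inv_ne_zero.2 hNt
  · exact ENNReal.rpow_ne_top_of_nonneg h2.le (ENNReal.inv_ne_top.2 hN0)

end

end ObliviousGuesswork

theorem theorem4 {X Y : Type*} [Fintype X] [Fintype Y] (P : PMF (X × Y)) (ρ : ℝ) (hρ : 0 < ρ) :
    ObliviousGuesswork.obliviousLeakage ρ P =
      (ρ : EReal) * ⨆ (Q : PMF X) (h : ObliviousGuesswork.AbsCont Q (P.map Prod.fst)),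
        ((ObliviousGuesswork.arimotoMI (1 / (1 + ρ))
          (ObliviousGuesswork.tiltedJoint P Q h) : ℝ) : EReal) := by
  have hρ0 : (0 : EReal) < ρ := EReal.coe_pos.2 hρ
  refine le_antisymm ?_ ?_
  · refine iSup_le fun U => iSup_le fun _ => iSup_le fun R => iSup_le fun hR => ?_
    obtain ⟨Q, hQ, hle⟩ := hR.exists_tilt hρ
    refine (ENNReal.log_le_log hle).trans ?_
    rw [ObliviousGuesswork.log_weightRatio_eq_arimotoMI hρ P Q hQ, EReal.coe_mul]
    exact mul_le_mul_of_nonneg_left (le_iSup₂_of_le Q hQ le_rfl) hρ0.le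
  -- Dividing by `ρ` frees the supremum, so that each `Q` can be treated separately.
  · rw [mul_comm, ← EReal.le_div_iff_mul_le hρ0 (EReal.coe_ne_top ρ)]
    refine iSup₂_le fun Q hQ => ?_
    rw [EReal.le_div_iff_mul_le hρ0 (EReal.coe_ne_top ρ), mul_comm, ← EReal.coe_mul,
      ← ObliviousGuesswork.log_weightRatio_eq_arimotoMI hρ P Q hQ]
    exact ObliviousGuesswork.log_weightRatio_tilt_le hρ P Q hQ
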